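/- Let $\mathbb S\subset\mathbb R$ be finite and let $G=(G(x,z))_{x,z\in\mathbb S}$ be a transition rate matrix, i.e. $G(x,z)\ge 0$ for $z\ne x$ and $G(x,x)=-\sum_{z\neq x}G(x,z)$. Let $Y$ be a continuous-time Markov chain on $\mathbb S$ with rate matrix $G$ and right-continuous paths. Write $\overline Y$ and $\underline Y$ for the running maximum and minimum of $Y$; when initial values $Y_0=x$, $\overline Y_0=x$, $\underline Y_0=y$ (with $y\le x$) are prescribed, $\overline Y_t=x\vee\sup_{0\le u\le t}Y_u$ and $\underline Y_t=y\wedge\inf_{0\le u\le t}Y_u$, and $\mathbb E_{x,y}$ denotes the corresponding expectation. With $\inf\emptyset=\infty$, put $$T_U=\inf\{t>0:Y_t\notin U\}\ (U\subseteq\mathbb R),\quad T_r^+=T_{(-\infty,r]},\quad T_\ell^-=T_{(\ell,\infty)},$$ $$\tau_a=\inf\{t\ge 0:\overline Y_t-Y_t\ge a\},\quad \widehat\tau_b=\inf\{t\ge 0:Y_t-\underline Y_t\ge b\}.$$ Fix $q\in\mathbb C$ with $\Re q>0$. For $f:\mathbb S\to\mathbb C$, $g:\mathbb S\times\mathbb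 S\to\mathbb C$ and real $\ell<r$ define $$P_U(q,x;f)=\mathbb E\big[e^{-qT_U}\mathbf 1_{\{T_U<\infty\}}f(Y_{T_U})\,\big|\,Y_0=x\big],\qquad A(q,x,y)=\mathbb E_{x,y}\big[e^{-q\tau_a}\mathbf 1_{\{\tau_a<\widehat\tau_b\}}f(Y_{\tau_a})\big],$$ $$R_{(\ell,r]}(q,x,y;g)=\mathbb E\big[e^{-qT_r^+}\mathbf 1_{\{T_\ell^->T_r^+\}}\,g(Y_{T_r^+},\underline Y_{T_r^+})\,\big|\,Y_0=x,\ \underline Y_0=y\big].$$ (i) Suppose $b\ge a>0$. For every $f:\mathbb S\to\mathbb C$, $x\in\mathbb S$ and $y\in\mathbb S\cap(x-a,x]$, $$A(q,x,y)=P_{(x-a,x]}\big(q,x;f(\cdot)\mathbf 1_{\{\cdot\le x-a\}}\big)+\sum_{\substack{z\in\mathbb S\cap(x,\,y+b)\\ w\in\mathbb S\cap((x-a)\vee(z-b),\,y]}}R_{(x-a,x]}\big(q,x,y;\mathbf 1_{\{\cdot=z,\ \tilde\cdot=w\}}\big)\,A(q,z,w),$$ where $\mathbf 1_{\{\cdot=z,\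 \tilde\cdot=w\}}$ is the function $g(s,m)=\mathbf 1_{\{s=z,\ m=w\}}$. (ii) For all real $\ell<r$, every $g:\mathbb S\times\mathbb S\to\mathbb C$ and all $x,y\in\mathbb S$ with $x\ge y$, $$\begin{cases} q\,R_{(\ell,r]}(q,x,y;g)-\displaystyle\sum_{z\in\mathbb S}G(x,z)\,R_{(\ell,r]}(q,z,y\wedge z;g)=0, & x\in(\ell,r],\\[1ex] R_{(\ell,r]}(q,x,y;g)=g(x,y)\,\mathbf 1_{\{x>r\}}, & x\notin(\ell,r].\end{cases}$$ -/

import Mathlib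

open scoped NNReal ENNReal

noncomputable section

namespace CTMC

/-- Transition rate matrix on the finite state space `S ⊆ ℝ`: nonnegative off-diagonal entries and
rows summing to zero. -/
structure IsRateMatrix {S : Finset ℝ} (G : Matrix S S ℝ) : Prop where
  offDiag_nonneg : ∀ x y : S, y ≠ x → 0 ≤ G x y
  diag_eq : ∀ x : S, G x x = -∑ y ∈ Finset.univ.erase x, G x y

/-- `Y` is, under the family of laws `μ x` (`x` the starting state), a continuous-time Markov chain
on `S` with rate matrix `G`: its paths are right-continuous (for the topology of `S`, which is
discrete) and its finite-dimensional distributions are those given by the transition matrices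
`p(t) = exp (t G)`, started from `x` at time `0`. The case `n = 0` says `μ x (Y 0 = x) = 1`. -/
structure IsCTMC {Ω : Type*} [MeasurableSpace Ω] {S : Finset ℝ} (G : Matrix S S ℝ)
    (μ : S → MeasureTheory.Measure Ω) (Y : ℝ≥0 → Ω → S) : Prop where
  prob : ∀ x, MeasureTheory.IsProbabilityMeasure (μ x)
  measurable : ∀ t, Measurable (Y t)
  rightCont : ∀ ω t, ContinuousWithinAt (fun s => Y s ω) (Set.Ici t) t
  fdd : ∀ (x : S) (n : ℕ) (t : ℕ → ℝ≥0) (z : ℕ → S), Monotone t → t 0 = 0 → z 0 = x →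
    μ x {ω | ∀ i ≤ n, Y (t i) ω = z i} =
      ENNReal.ofReal (∏ i ∈ Finset.range n,
        NormedSpace.exp (((t (i + 1) : ℝ) - (t i : ℝ)) • G) (z i) (z (i + 1)))

variable {S : Finset ℝ}

/-- Running maximum at time `t` of the path `p` with initial maximum `m`: the largest element of
`{m} ∪ {p u : 0 ≤ u ≤ t}`. -/
def runMax (m : S) (p : ℝ≥0 → S) (t : ℝ≥0) : S :=
  (Set.toFinite (insert m (p '' Set.Iic t))).toFinset.max' ⟨m, by simp⟩

/-- Running minimum at time `t` of the path `p` with initial minimum `m`: the smallest element of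
`{m} ∪ {p u : 0 ≤ u ≤ t}`. -/
def runMin (m : S) (p : ℝ≥0 → S) (t : ℝ≥0) : S :=
  (Set.toFinite (insert m (p '' Set.Iic t))).toFinset.min' ⟨m, by simp⟩

theorem coe_runMax (m : S) (p : ℝ≥0 → S) (t : ℝ≥0) :
    (runMax m p t : ℝ) = max (m : ℝ) (⨆ u : Set.Iic t, (p u : ℝ)) := by
  have hmem := Finset.max'_mem (Set.toFinite (insert m (p '' Set.Iic t))).toFinset ⟨m, by simp⟩
  have hle := Finset.le_max' (Set.toFinite (insert m (p '' Set.Iic t))).toFinset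
  rw [Set.Finite.mem_toFinset] at hmem
  change runMax m p t ∈ _ at hmem
  have hm : (m : ℝ) ≤ runMax m p t := hle m (by simp)
  have hp : ∀ u : Set.Iic t, (p u : ℝ) ≤ runMax m p t := fun u =>
    hle (p u) ((Set.Finite.mem_toFinset _).2 (Or.inr ⟨u, u.2, rfl⟩))
  have : Nonempty (Set.Iic t) := ⟨⟨t, Set.mem_Iic.2 le_rfl⟩⟩
  refine le_antisymm ?_ (max_le hm (ciSup_le hp))
  rcases hmem with h | ⟨u, hu, h⟩
  · rw [h]; exact le_max_left _ _
  · rw [← h] at hp ⊢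
    exact le_max_of_le_right (le_ciSup (f := fun u : Set.Iic t => (p u : ℝ))
      ⟨_, Set.forall_mem_range.2 hp⟩ ⟨u, hu⟩)

theorem coe_runMin (m : S) (p : ℝ≥0 → S) (t : ℝ≥0) :
    (runMin m p t : ℝ) = min (m : ℝ) (⨅ u : Set.Iic t, (p u : ℝ)) := by
  have hmem := Finset.min'_mem (Set.toFinite (insert m (p '' Set.Iic t))).toFinset ⟨m, by simp⟩
  have hle := Finset.min'_le (Set.toFinite (insert m (p '' Set.Iic t))).toFinset
  rw [Set.Finite.mem_toFinset] at hmem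
  change runMin m p t ∈ _ at hmem
  have hm : (runMin m p t : ℝ) ≤ m := hle m (by simp)
  have hp : ∀ u : Set.Iic t, (runMin m p t : ℝ) ≤ p u := fun u =>
    hle (p u) ((Set.Finite.mem_toFinset _).2 (Or.inr ⟨u, u.2, rfl⟩))
  have : Nonempty (Set.Iic t) := ⟨⟨t, Set.mem_Iic.2 le_rfl⟩⟩
  refine le_antisymm (le_min hm (le_ciInf hp)) ?_
  rcases hmem with h | ⟨u, hu, h⟩
  · rw [h]; exact min_le_left _ _
  · rw [← h] at hp ⊢
    exact min_le_of_right_le (ciInf_le (f := fun u : Set.Iic t => (p u : ℝ))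
      ⟨_, Set.forall_mem_range.2 hp⟩ ⟨u, hu⟩)

/-- First passage time `inf {t > 0 : p t ∉ U}`, with `inf ∅ = ∞`. -/
def exitTime (U : Set ℝ) (p : ℝ≥0 → S) : ℝ≥0∞ :=
  ⨅ (t : ℝ≥0) (_ : 0 < t ∧ (p t : ℝ) ∉ U), (t : ℝ≥0∞)

/-- Drawdown time `inf {t ≥ 0 : max_t - p t ≥ a}`, the running maximum starting from `m`. -/
def drawdownTime (a : ℝ) (m : S) (p : ℝ≥0 → S) : ℝ≥0∞ :=
  ⨅ (t : ℝ≥0) (_ : a ≤ (runMax m p t : ℝ) - (p t : ℝ)), (t : ℝ≥0∞)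

/-- Drawup time `inf {t ≥ 0 : p t - min_t ≥ b}`, the running minimum starting from `m`. -/
def drawupTime (b : ℝ) (m : S) (p : ℝ≥0 → S) : ℝ≥0∞ :=
  ⨅ (t : ℝ≥0) (_ : b ≤ (p t : ℝ) - (runMin m p t : ℝ)), (t : ℝ≥0∞)

open Classical in
/-- `P_U(q, x; f) = E_x [e^{-q T_U} 1{T_U < ∞} f(Y_{T_U})]`. -/
def exitP {Ω : Type*} [MeasurableSpace Ω] (μ : S → MeasureTheory.Measure Ω) (Y : ℝ≥0 → Ω → S)
    (U : Set ℝ) (q : ℂ) (x : S) (f : S → ℂ) : ℂ :=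
  ∫ ω, (let T := exitTime U (fun t => Y t ω)
    if T < ∞ then Complex.exp (-q * (T.toReal : ℂ)) * f (Y T.toNNReal ω) else 0) ∂(μ x)

open Classical in
/-- `A(q, x, y) = E_{x,y} [e^{-q τ_a} 1{τ_a < τ̂_b} f(Y_{τ_a})]`, where the chain and its running
maximum start at `x` and its running minimum starts at `y`. -/
def drawdownA {Ω : Type*} [MeasurableSpace Ω] (μ : S → MeasureTheory.Measure Ω) (Y : ℝ≥0 → Ω → S)
    (a b : ℝ) (f : S → ℂ) (q : ℂ) (x y : S) : ℂ :=
  ∫ ω, (let τ := drawdownTime a x (fun t => Y t ω)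
    if τ < drawupTime b y (fun t => Y t ω) then
      Complex.exp (-q * (τ.toReal : ℂ)) * f (Y τ.toNNReal ω) else 0) ∂(μ x)

open Classical in
/-- `R_{(ℓ,r]}(q, x, y; g) = E [e^{-q T_r⁺} 1{T_ℓ⁻ > T_r⁺} g(Y_{T_r⁺}, min_{T_r⁺})]`, where the chain
starts at `x`, its running minimum starts at `y`, `T_r⁺` is the first exit from `(-∞, r]` and
`T_ℓ⁻` is the first exit from `(ℓ, ∞)`. -/
def upExitR {Ω : Type*} [MeasurableSpace Ω] (μ : S → MeasureTheory.Measure Ω) (Y : ℝ≥0 → Ω → S)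
    (ℓ r : ℝ) (q : ℂ) (x y : S) (g : S → S → ℂ) : ℂ :=
  ∫ ω, (let T := exitTime (Set.Iic r) (fun t => Y t ω)
    if T < exitTime (Set.Ioi ℓ) (fun t => Y t ω) then
      Complex.exp (-q * (T.toReal : ℂ)) *
        g (Y T.toNNReal ω) (runMin y (fun t => Y t ω) T.toNNReal) else 0) ∂(μ x)

end CTMC

end

namespace CTMC

open Filter Topology MeasureTheory

variable {S : Finset ℝ}

/-! ### Right-continuous paths -/

theorem le_runMax_iff (m : S) (p : ℝ≥0 → S) (t : ℝ≥0) (c : S) :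
    c ≤ runMax m p t ↔ c ≤ m ∨ ∃ u ≤ t, c ≤ p u := by
  have h : runMax m p t < c ↔ _ :=
    Finset.max'_lt_iff (Set.toFinite (insert m (p '' Set.Iic t))).toFinset ⟨m, by simp⟩
  rw [← not_lt, h]
  simp only [Set.Finite.mem_toFinset, Set.forall_mem_insert, Set.forall_mem_image, Set.mem_Iic,
    not_and_or, not_lt, not_forall, exists_prop]

theorem runMin_le_iff (m : S) (p : ℝ≥0 → S) (t : ℝ≥0) (c : S) :
    runMin m p t ≤ c ↔ m ≤ c ∨ ∃ u ≤ t, p u ≤ c := by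
  have h : c < runMin m p t ↔ _ :=
    Finset.lt_min'_iff (Set.toFinite (insert m (p '' Set.Iic t))).toFinset ⟨m, by simp⟩
  rw [← not_lt, h]
  simp only [Set.Finite.mem_toFinset, Set.forall_mem_insert, Set.forall_mem_image, Set.mem_Iic,
    not_and_or, not_lt, not_forall, exists_prop]

/-- A property of times that, at every time, keeps its truth value for a while to the right. -/
def RightStable (P : ℝ≥0 → Prop) : Prop :=
  ∀ t, ∃ v > t, ∀ u ∈ Set.Ico t v, (P u ↔ P t)

theorem exists_Ico_eq {p : ℝ≥0 → S} (hp : ∀ t, ContinuousWithinAt p (Set.Ici t) t) (t : ℝ≥0) :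
    ∃ v > t, ∀ u ∈ Set.Ico t v, p u = p t := by
  have h : {u | p u = p t} ∈ 𝓝[≥] t :=
    (hp t).tendsto (mem_nhds_discrete.2 (show p t ∈ {c | c = p t} from rfl))
  obtain ⟨v, hv, hsub⟩ := mem_nhdsGE_iff_exists_Ico_subset.1 h
  exact ⟨v, hv, fun u hu => hsub hu⟩

/-- The chain together with its running maximum and its running minimum. -/
noncomputable def stateAt (M m : S) (p : ℝ≥0 → S) (t : ℝ≥0) : S × S × S :=
  (p t, runMax M p t, runMin m p t)

theorem exists_Ico_stateAt_eq {p : ℝ≥0 → S} (hp : ∀ t, ContinuousWithinAt p (Set.Ici t) t)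
    (M m : S) (t : ℝ≥0) :
    ∃ v > t, ∀ u ∈ Set.Ico t v, stateAt M m p u = stateAt M m p t := by
  obtain ⟨v, hv, h⟩ := exists_Ico_eq hp t
  have key : ∀ u ∈ Set.Ico t v, ∀ w ≤ u, ∃ w' ≤ t, p w' = p w := fun u hu w hw => by
    rcases le_total w t with hwt | hwt
    · exact ⟨w, hwt, rfl⟩
    · exact ⟨t, le_rfl, (h w ⟨hwt, hw.trans_lt hu.2⟩).symm⟩
  refine ⟨v, hv, fun u hu => ?_⟩
  unfold stateAt
  refine Prod.ext (h u hu) (Prod.ext ?_ ?_)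
  · refine eq_of_forall_le_iff fun c => ?_
    simp only [le_runMax_iff]
    refine or_congr Iff.rfl ⟨?_, ?_⟩
    · rintro ⟨w, hw, hc⟩
      obtain ⟨w', hw', e⟩ := key u hu w hw
      exact ⟨w', hw', e ▸ hc⟩
    · rintro ⟨w, hw, hc⟩
      exact ⟨w, hw.trans hu.1, hc⟩
  · refine eq_of_forall_ge_iff fun c => ?_
    simp only [runMin_le_iff]
    refine or_congr Iff.rfl ⟨?_, ?_⟩
    · rintro ⟨w, hw, hc⟩
      obtain ⟨w', hw', e⟩ := key u hu w hw
      exact ⟨w', hw', e ▸ hc⟩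
    · rintro ⟨w, hw, hc⟩
      exact ⟨w, hw.trans hu.1, hc⟩

theorem rightStable_stateAt {p : ℝ≥0 → S} (hp : ∀ t, ContinuousWithinAt p (Set.Ici t) t)
    (M m : S) (Q : S × S × S → Prop) : RightStable fun t => Q (stateAt M m p t) := fun t => by
  obtain ⟨v, hv, h⟩ := exists_Ico_stateAt_eq hp M m t
  exact ⟨v, hv, fun u hu => by simp only [h u hu]⟩

/-- The first time at which `P` holds, `∞` if there is none. -/
noncomputable def hitTime (P : ℝ≥0 → Prop) : ℝ≥0∞ := ⨅ (t : ℝ≥0) (_ : P t), (t : ℝ≥0∞)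

theorem hitTime_le {P : ℝ≥0 → Prop} {t : ℝ≥0} (h : P t) : hitTime P ≤ t := iInf₂_le t h

theorem hitTime_eq_coe {P : ℝ≥0 → Prop} {T : ℝ≥0} (h : P T) (h' : ∀ t < T, ¬ P t) :
    hitTime P = T :=
  le_antisymm (hitTime_le h) (le_iInf₂ fun t ht =>
    ENNReal.coe_le_coe.2 (not_lt.1 fun hlt => h' t hlt ht))

theorem hitTime_eq_top {P : ℝ≥0 → Prop} (h : ∀ t, ¬ P t) : hitTime P = ∞ :=
  top_le_iff.1 (le_iInf₂ fun t ht => absurd ht (h t))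

theorem RightStable.exists_first {P : ℝ≥0 → Prop} (hP : RightStable P) (h : ∃ t, P t) :
    ∃ T, P T ∧ ∀ t < T, ¬ P t := by
  obtain ⟨v, hv, hs⟩ := hP (sInf {t | P t})
  obtain ⟨t, ht, htv⟩ := exists_lt_of_csInf_lt (s := {t | P t}) h hv
  exact ⟨_, (hs t ⟨csInf_le (OrderBot.bddBelow _) ht, htv⟩).1 ht,
    fun s hs h => (not_lt.2 (csInf_le (OrderBot.bddBelow _) h)) hs⟩

theorem RightStable.hitTime_spec {P : ℝ≥0 → Prop} (hP : RightStable P) :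
    (hitTime P = ∞ ∧ ∀ t, ¬ P t) ∨ ∃ T : ℝ≥0, hitTime P = T ∧ P T ∧ ∀ t < T, ¬ P t := by
  by_cases h : ∃ t, P t
  · obtain ⟨T, hT, hT'⟩ := hP.exists_first h
    exact Or.inr ⟨T, hitTime_eq_coe hT hT', hT, hT'⟩
  · rw [not_exists] at h
    exact Or.inl ⟨hitTime_eq_top h, h⟩

theorem exitTime_eq_hitTime {p : ℝ≥0 → S} (hp : ∀ t, ContinuousWithinAt p (Set.Ici t) t)
    (U : Set ℝ) : exitTime U p = hitTime fun t => (p t : ℝ) ∉ U := by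
  refine le_antisymm (le_iInf₂ fun t ht => ?_) (le_iInf₂ fun t ht => hitTime_le ht.2)
  rcases eq_or_ne t 0 with rfl | h0
  · obtain ⟨v, hv, h⟩ := exists_Ico_eq hp 0
    refine le_of_forall_gt fun c hc => ?_
    obtain ⟨d, hd, hdc⟩ := ENNReal.lt_iff_exists_nnreal_btwn.1 hc
    obtain ⟨u, hu, hu'⟩ := exists_between (lt_min hv (ENNReal.coe_lt_coe.1 hd))
    refine (iInf₂_le u ⟨hu, ?_⟩).trans_lt
      ((ENNReal.coe_lt_coe.2 (hu'.trans_le (min_le_right _ _))).trans hdc)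
    rw [h u ⟨hu.le, hu'.trans_le (min_le_left _ _)⟩]
    exact ht
  · exact iInf₂_le t ⟨pos_iff_ne_zero.2 h0, ht⟩

open Classical in
/-- Discounted payoff `φ`, received when the state first enters `D`. -/
noncomputable def stoppedPayoff (D : Set (S × S × S)) (φ : S × S × S → ℂ) (q : ℂ) (M m : S)
    (p : ℝ≥0 → S) : ℂ :=
  let T := hitTime fun t => stateAt M m p t ∈ D
  if T < ∞ then Complex.exp (-q * (T.toReal : ℂ)) * φ (stateAt M m p T.toNNReal) else 0

section payoff

variable {D : Set (S × S × S)} {φ : S × S × S → ℂ} {q : ℂ} {M m : S} {p : ℝ≥0 → S}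

theorem stoppedPayoff_of_forall_notMem (h : ∀ t, stateAt M m p t ∉ D) :
    stoppedPayoff D φ q M m p = 0 := by
  simp [stoppedPayoff, hitTime_eq_top h]

theorem stoppedPayoff_of_first {T : ℝ≥0} (h : stateAt M m p T ∈ D)
    (h' : ∀ t < T, stateAt M m p t ∉ D) :
    stoppedPayoff D φ q M m p = Complex.exp (-q * (T : ℂ)) * φ (stateAt M m p T) := by
  simp [stoppedPayoff, hitTime_eq_coe h h']

end payoff

theorem stateAt_zero {M m : S} {p : ℝ≥0 → S} (hM : p 0 ≤ M) (hm : m ≤ p 0) :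
    stateAt M m p 0 = (p 0, M, m) := by
  unfold stateAt
  refine Prod.ext rfl (Prod.ext ?_ ?_)
  · refine eq_of_forall_le_iff fun c => ?_
    simp only [le_runMax_iff, nonpos_iff_eq_zero, exists_eq_left]
    exact ⟨fun h => h.elim id fun h => h.trans hM, Or.inl⟩
  · refine eq_of_forall_ge_iff fun c => ?_
    simp only [runMin_le_iff, nonpos_iff_eq_zero, exists_eq_left]
    exact ⟨fun h => h.elim id fun h => hm.trans h, Or.inl⟩

/-! ### Sampling a path along a grid -/

/-- The state after a move of the chain to `z`. -/
def moveTo (e : S × S × S) (z : S) : S × S × S := (z, e.2.1 ⊔ z, e.2.2 ⊓ z)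

/-- The successive states of a chain that starts in state `e` and visits `ξ 0, ξ 1, …`. -/
def orbit (e : S × S × S) (ξ : ℕ → S) : ℕ → S × S × S
  | 0 => e
  | k + 1 => moveTo (orbit e ξ k) (ξ k)

theorem orbit_succ' (e : S × S × S) (ξ : ℕ → S) (k : ℕ) :
    orbit e ξ (k + 1) = orbit (moveTo e (ξ 0)) (fun j => ξ (j + 1)) k := by
  induction k with
  | zero => rfl
  | succ k ih => rw [orbit, ih]; rfl

theorem le_orbit_max_iff (e : S × S × S) (ξ : ℕ → S) (k : ℕ) (c : S) :
    c ≤ (orbit e ξ k).2.1 ↔ c ≤ e.2.1 ∨ ∃ j < k, c ≤ ξ j := by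
  induction k with
  | zero => simp [orbit]
  | succ k ih => simp only [orbit, moveTo, le_sup_iff, ih, Nat.exists_lt_succ_right, or_assoc]

theorem orbit_min_le_iff (e : S × S × S) (ξ : ℕ → S) (k : ℕ) (c : S) :
    (orbit e ξ k).2.2 ≤ c ↔ e.2.2 ≤ c ∨ ∃ j < k, ξ j ≤ c := by
  induction k with
  | zero => simp [orbit]
  | succ k ih => simp only [orbit, moveTo, inf_le_iff, ih, Nat.exists_lt_succ_right, or_assoc]

/-- The grid point that follows a time `T`. -/
theorem ceil_mul_bounds {h : ℝ≥0} (hh : 0 < h) (T : ℝ≥0) :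
    T ≤ ⌈T / h⌉₊ * h ∧ ⌈T / h⌉₊ * h < T + h ∧
      ∀ k : ℕ, T ≤ k * h → ⌈T / h⌉₊ ≤ k := by
  refine ⟨(div_le_iff₀ hh).1 (Nat.le_ceil _), ?_, fun k hk => Nat.ceil_le.2 ((div_le_iff₀ hh).2 hk)⟩
  have := mul_lt_mul_of_pos_right (Nat.ceil_lt_add_one (zero_le (a := T / h))) hh
  rwa [add_mul, one_mul, div_mul_cancel₀ _ hh.ne'] at this

theorem eventually_small {T v : ℝ≥0} (hv : T < v) : ∀ᶠ h : ℝ≥0 in 𝓝[>] 0, T + h < v := by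
  have : ∀ᶠ h : ℝ≥0 in 𝓝 0, T + h < v := by
    have hc : Tendsto (fun h : ℝ≥0 => T + h) (𝓝 0) (𝓝 (T + 0)) := tendsto_const_nhds.add tendsto_id
    rw [add_zero] at hc
    exact hc.eventually_lt_const hv
  exact this.filter_mono nhdsWithin_le_nhds

/-- A sufficiently fine grid sees every value that the path takes, and as early as possible. -/
theorem eventually_grid_visits {p : ℝ≥0 → S} (hp : ∀ t, ContinuousWithinAt p (Set.Ici t) t) :
    ∀ᶠ h : ℝ≥0 in 𝓝[>] 0, ∀ (c : S) (k : ℕ), (∃ u ≤ k * h, p u = c) → ∃ j ≤ k, p (j * h) = c := by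
  refine eventually_all.2 fun c => ?_
  by_cases hc : ∃ u, p u = c
  · have hst : RightStable fun t => p t = c := fun t => by
      obtain ⟨v, hv, h⟩ := exists_Ico_eq hp t
      exact ⟨v, hv, fun u hu => by simp only [h u hu]⟩
    obtain ⟨T, hT, hT'⟩ := hst.exists_first hc
    obtain ⟨v, hv, hpv⟩ := exists_Ico_eq hp T
    filter_upwards [eventually_small hv, self_mem_nhdsWithin] with h hh h0 k hk
    obtain ⟨u, hu, huc⟩ := hk
    obtain ⟨h1, h2, h3⟩ := ceil_mul_bounds (Set.mem_Ioi.1 h0) T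
    have hTu : T ≤ u := not_lt.1 fun hlt => hT' u hlt huc
    exact ⟨_, h3 k (hTu.trans hu), (hpv _ ⟨h1, h2.trans hh⟩).trans hT⟩
  · exact Eventually.of_forall fun h k ⟨u, _, hu⟩ => absurd ⟨u, hu⟩ hc

theorem eventually_orbit_eq {p : ℝ≥0 → S} (hp : ∀ t, ContinuousWithinAt p (Set.Ici t) t)
    {M m : S} (hM : p 0 ≤ M) (hm : m ≤ p 0) :
    ∀ᶠ h : ℝ≥0 in 𝓝[>] 0, ∀ k : ℕ,
      orbit (p 0, M, m) (fun j => p ((j + 1 : ℕ) * h)) k = stateAt M m p (k * h) := by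
  filter_upwards [eventually_grid_visits hp] with h hv k
  have hfst : (orbit (p 0, M, m) (fun j => p ((j + 1 : ℕ) * h)) k).1 = p (k * h) := by
    cases k with
    | zero => simp [orbit]
    | succ k => rfl
  have back : ∀ j < k, ((j + 1 : ℕ) : ℝ≥0) * h ≤ k * h := fun j hj =>
    mul_le_mul_of_nonneg_right (Nat.cast_le.2 hj) zero_le
  refine Prod.ext hfst (Prod.ext ?_ ?_)
  · refine eq_of_forall_le_iff fun c => ?_
    simp only [stateAt, le_runMax_iff, le_orbit_max_iff]
    constructor
    · rintro (hc | ⟨j, hj, hc⟩)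
      · exact Or.inl hc
      · exact Or.inr ⟨_, back j hj, hc⟩
    · rintro (hc | ⟨u, hu, hc⟩)
      · exact Or.inl hc
      · obtain ⟨j, hj, e⟩ := hv (p u) k ⟨u, hu, rfl⟩
        cases j with
        | zero => rw [Nat.cast_zero, zero_mul] at e; exact Or.inl ((e ▸ hc).trans hM)
        | succ j => exact Or.inr ⟨j, hj, e ▸ hc⟩
  · refine eq_of_forall_ge_iff fun c => ?_
    simp only [stateAt, runMin_le_iff, orbit_min_le_iff]
    constructor
    · rintro (hc | ⟨j, hj, hc⟩)
      · exact Or.inl hc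
      · exact Or.inr ⟨_, back j hj, hc⟩
    · rintro (hc | ⟨u, hu, hc⟩)
      · exact Or.inl hc
      · obtain ⟨j, hj, e⟩ := hv (p u) k ⟨u, hu, rfl⟩
        cases j with
        | zero => rw [Nat.cast_zero, zero_mul] at e; exact Or.inl (hm.trans (e ▸ hc))
        | succ j => exact Or.inr ⟨j, hj, e ▸ hc⟩

open Classical in
/-- Payoff at the first entrance of `orbit e ξ` in `D`, discounted by `γ` in every step. -/
noncomputable def gridPayoff (D : Set (S × S × S)) (φ : S × S × S → ℂ) (γ : ℂ) (e : S × S × S)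
    (ξ : ℕ → S) : ℂ :=
  if h : ∃ k, orbit e ξ k ∈ D then γ ^ Nat.find h * φ (orbit e ξ (Nat.find h)) else 0

theorem gridPayoff_of_first {D : Set (S × S × S)} {φ : S × S × S → ℂ} {γ : ℂ} {e : S × S × S}
    {ξ : ℕ → S} {k : ℕ} (hk : orbit e ξ k ∈ D) (hk' : ∀ j < k, orbit e ξ j ∉ D) :
    gridPayoff D φ γ e ξ = γ ^ k * φ (orbit e ξ k) := by
  classical
  have h : ∃ k, orbit e ξ k ∈ D := ⟨k, hk⟩
  have : Nat.find h = k := (Nat.find_eq_iff h).2 ⟨hk, hk'⟩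
  rw [gridPayoff, dif_pos h, this]

theorem tendsto_gridPayoff {p : ℝ≥0 → S} (hp : ∀ t, ContinuousWithinAt p (Set.Ici t) t)
    {M m : S} (hM : p 0 ≤ M) (hm : m ≤ p 0) (D : Set (S × S × S)) (φ : S × S × S → ℂ) (q : ℂ) :
    Tendsto (fun h : ℝ≥0 => gridPayoff D φ (Complex.exp (-q * (h : ℂ))) (p 0, M, m)
      (fun j => p ((j + 1 : ℕ) * h))) (𝓝[>] 0) (𝓝 (stoppedPayoff D φ q M m p)) := by
  by_cases hD : ∃ t, stateAt M m p t ∈ D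
  · obtain ⟨T, hT, hT'⟩ := (rightStable_stateAt hp M m (· ∈ D)).exists_first hD
    obtain ⟨v, hv, hst⟩ := exists_Ico_stateAt_eq hp M m T
    rw [stoppedPayoff_of_first hT hT']
    have hlim : Tendsto (fun h : ℝ≥0 => ⌈T / h⌉₊ * h) (𝓝[>] 0) (𝓝 T) := by
      have hub : Tendsto (fun h : ℝ≥0 => T + h) (𝓝[>] 0) (𝓝 T) := by
        have hc : Tendsto (fun h : ℝ≥0 => T + h) (𝓝 0) (𝓝 (T + 0)) :=
          tendsto_const_nhds.add tendsto_id
        rw [add_zero] at hc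
        exact hc.mono_left nhdsWithin_le_nhds
      refine tendsto_of_tendsto_of_tendsto_of_le_of_le' tendsto_const_nhds hub ?_ ?_
      · filter_upwards [self_mem_nhdsWithin] with h h0 using (ceil_mul_bounds h0 T).1
      · filter_upwards [self_mem_nhdsWithin] with h h0 using (ceil_mul_bounds h0 T).2.1.le
    have hexp : Tendsto (fun h : ℝ≥0 => Complex.exp (-q * ((⌈T / h⌉₊ * h : ℝ≥0) : ℂ)) *
        φ (stateAt M m p T)) (𝓝[>] 0)
        (𝓝 (Complex.exp (-q * (T : ℂ)) * φ (stateAt M m p T))) := by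
      have hc : Continuous fun t : ℝ≥0 => Complex.exp (-q * (t : ℂ)) * φ (stateAt M m p T) := by
        fun_prop
      exact (hc.tendsto T).comp hlim
    refine hexp.congr' ?_
    filter_upwards [eventually_orbit_eq hp hM hm, eventually_small hv, self_mem_nhdsWithin]
      with h ho hs h0
    obtain ⟨h1, h2, h3⟩ := ceil_mul_bounds (Set.mem_Ioi.1 h0) T
    have hX := hst _ ⟨h1, h2.trans hs⟩
    rw [gridPayoff_of_first (k := ⌈T / h⌉₊), ho, hX, ← Complex.exp_nat_mul]
    · congr 2
      push_cast
      ring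
    · rw [ho, hX]; exact hT
    · intro j hj
      rw [ho]
      refine hT' _ (not_le.1 fun hle => ?_)
      exact absurd (h3 j hle) (not_le.2 hj)
  · rw [not_exists] at hD
    rw [stoppedPayoff_of_forall_notMem hD]
    refine tendsto_const_nhds.congr' ?_
    filter_upwards [eventually_orbit_eq hp hM hm] with h ho
    rw [gridPayoff, dif_neg]
    rintro ⟨k, hk⟩
    exact hD _ (ho k ▸ hk)

/-! ### The transition matrices -/

section exponential

attribute [local instance] Matrix.linftyOpNormedRing Matrix.linftyOpNormedAlgebra

theorem exp_apply_nonneg {n : Type*} [Fintype n] [DecidableEq n] {A : Matrix n n ℝ}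
    (hA : ∀ i j, 0 ≤ A i j) (i j : n) : 0 ≤ NormedSpace.exp A i j := by
  have hs : HasSum (fun k : ℕ => ((k.factorial : ℝ)⁻¹) • A ^ k) (NormedSpace.exp A) :=
    NormedSpace.exp_series_hasSum_exp' (𝕂 := ℝ) A
  have hij := hs.map (Matrix.entryAddMonoidHom ℝ i j) (by
    exact (continuous_apply j).comp (continuous_apply i))
  have hpow : ∀ (k : ℕ) (i j : n), 0 ≤ (A ^ k) i j := fun k => by
    induction k with
    | zero => intro i j; rw [pow_zero, Matrix.one_apply]; split_ifs <;> simp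
    | succ k ih =>
      intro i j
      rw [pow_succ, Matrix.mul_apply]
      exact Finset.sum_nonneg fun l _ => mul_nonneg (ih i l) (hA l j)
  refine hij.nonneg fun k => ?_
  simp only [Function.comp, Matrix.entryAddMonoidHom_apply, Matrix.smul_apply, smul_eq_mul]
  exact mul_nonneg (by positivity) (hpow k i j)

theorem exp_apply_nonneg_of_offDiag {n : Type*} [Fintype n] [DecidableEq n] {A : Matrix n n ℝ}
    (hA : ∀ i j, j ≠ i → 0 ≤ A i j) (i j : n) : 0 ≤ NormedSpace.exp A i j := by
  set c : ℝ := ∑ k, |A k k| with hc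
  have hdec : A = (-c) • (1 : Matrix n n ℝ) + (A + c • 1) := by rw [neg_smul]; abel
  have hcomm : Commute ((-c) • (1 : Matrix n n ℝ)) (A + c • 1) :=
    (Commute.one_left _).smul_left _
  have hone : NormedSpace.exp ((-c) • (1 : Matrix n n ℝ)) = Real.exp (-c) • 1 := by
    rw [← Algebra.algebraMap_eq_smul_one, ← Algebra.algebraMap_eq_smul_one,
      Real.exp_eq_exp_ℝ]
    exact (NormedSpace.algebraMap_exp_comm (𝔸 := Matrix n n ℝ) (-c)).symm
  rw [hdec, Matrix.exp_add_of_commute _ _ hcomm, hone, Matrix.smul_mul, one_mul, Matrix.smul_apply]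
  refine mul_nonneg (Real.exp_pos _).le (exp_apply_nonneg (fun k l => ?_) i j)
  rw [Matrix.add_apply, Matrix.smul_apply, smul_eq_mul]
  rcases eq_or_ne l k with rfl | h
  · have : |A l l| ≤ c := Finset.single_le_sum (f := fun k => |A k k|)
      (fun _ _ => abs_nonneg _) (Finset.mem_univ l)
    simp only [Matrix.one_apply_eq, mul_one]
    linarith [neg_abs_le (A l l)]
  · simpa [Matrix.one_apply_ne' h] using hA k l h

theorem tendsto_exp_smul_slope {n : Type*} [Fintype n] [DecidableEq n] (A : Matrix n n ℝ)
    (i j : n) :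
    Tendsto (fun h : ℝ≥0 => ((NormedSpace.exp ((h : ℝ) • A) i j - (1 : Matrix n n ℝ) i j) / h : ℝ))
      (𝓝[>] 0) (𝓝 (A i j)) := by
  have hd : HasDerivAt (fun u : ℝ => NormedSpace.exp (u • A))
      (NormedSpace.exp ((0 : ℝ) • A) * A) 0 := hasDerivAt_exp_smul_const A (0 : ℝ)
  rw [zero_smul, NormedSpace.exp_zero, one_mul] at hd
  have hs := hasDerivAt_iff_tendsto_slope.1 hd
  have hcoe : Tendsto (fun h : ℝ≥0 => (h : ℝ)) (𝓝[>] 0) (𝓝[≠] 0) := by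
    refine tendsto_nhdsWithin_iff.2 ⟨?_, ?_⟩
    · exact (NNReal.continuous_coe.tendsto 0).mono_left nhdsWithin_le_nhds
    · filter_upwards [self_mem_nhdsWithin] with h h0
      exact NNReal.coe_ne_zero.2 (ne_of_gt h0)
  have he : Continuous fun B : Matrix n n ℝ => B i j :=
    (continuous_apply j).comp (continuous_apply i)
  refine ((he.tendsto A).comp (hs.comp hcoe)).congr fun h => ?_
  simp [slope, div_eq_inv_mul]

end exponential

/-! ### The chain along a grid -/

open Classical in
/-- `gridPayoff` with horizon `N`. -/
noncomputable def truncPayoff (D : Set (S × S × S)) (φ : S × S × S → ℂ) (γ : ℂ) :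
    ℕ → S × S × S → (ℕ → S) → ℂ
  | 0, e, _ => if e ∈ D then φ e else 0
  | N + 1, e, ξ => if e ∈ D then φ e else
      γ * truncPayoff D φ γ N (moveTo e (ξ 0)) fun j => ξ (j + 1)

open Classical in
/-- The expectation of `truncPayoff` for a chain with transition matrix `P`. -/
noncomputable def truncValue (D : Set (S × S × S)) (φ : S × S × S → ℂ) (γ : ℂ)
    (P : Matrix S S ℝ) : ℕ → S × S × S → ℂ
  | 0, e => if e ∈ D then φ e else 0
  | N + 1, e => if e ∈ D then φ e else γ * ∑ z, P e.1 z * truncValue D φ γ P N (moveTo e z)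

section discrete

variable {D : Set (S × S × S)} {φ : S × S × S → ℂ} {γ : ℂ}

theorem norm_truncPayoff_le (hγ : ‖γ‖ ≤ 1) {C : ℝ} (hC : ∀ e, ‖φ e‖ ≤ C) (N : ℕ) (e : S × S × S)
    (ξ : ℕ → S) : ‖truncPayoff D φ γ N e ξ‖ ≤ C := by
  have h0 : 0 ≤ C := (norm_nonneg _).trans (hC e)
  induction N generalizing e ξ with
  | zero => rw [truncPayoff]; split_ifs <;> simp [hC, h0]
  | succ N ih =>
    rw [truncPayoff]
    split_ifs
    · exact hC e
    · rw [norm_mul]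
      exact (mul_le_of_le_one_left (norm_nonneg _) hγ).trans (ih _ _)

theorem truncPayoff_of_first (k : ℕ) (e : S × S × S) (ξ : ℕ → S) (hk : orbit e ξ k ∈ D)
    (hk' : ∀ j < k, orbit e ξ j ∉ D) (N : ℕ) (hN : k ≤ N) :
    truncPayoff D φ γ N e ξ = γ ^ k * φ (orbit e ξ k) := by
  induction k generalizing e ξ N with
  | zero =>
    have he : e ∈ D := hk
    cases N <;> simp [truncPayoff, he, orbit]
  | succ k ih =>
    obtain ⟨N, rfl⟩ : ∃ N', N = N' + 1 := ⟨N - 1, by omega⟩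
    have he : e ∉ D := hk' 0 (Nat.succ_pos k)
    rw [truncPayoff, if_neg he, ih, orbit_succ', pow_succ']
    · ring
    · rwa [← orbit_succ']
    · intro j hj
      rw [← orbit_succ']
      exact hk' _ (by omega)
    · omega

theorem truncPayoff_of_forall_notMem (e : S × S × S) (ξ : ℕ → S) (h : ∀ j, orbit e ξ j ∉ D)
    (N : ℕ) : truncPayoff D φ γ N e ξ = 0 := by
  induction N generalizing e ξ with
  | zero => exact if_neg (h 0)
  | succ N ih =>
    have he : e ∉ D := h 0
    rw [truncPayoff, if_neg he, ih, mul_zero]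
    intro j
    rw [← orbit_succ']
    exact h _

theorem tendsto_truncPayoff (e : S × S × S) (ξ : ℕ → S) :
    Tendsto (fun N => truncPayoff D φ γ N e ξ) atTop (𝓝 (gridPayoff D φ γ e ξ)) := by
  classical
  refine tendsto_const_nhds.congr' ?_
  by_cases h : ∃ k, orbit e ξ k ∈ D
  · filter_upwards [eventually_ge_atTop (Nat.find h)] with N hN
    rw [truncPayoff_of_first _ e ξ (Nat.find_spec h) (fun j hj => Nat.find_min h hj) N hN,
      gridPayoff, dif_pos h]
  · refine Eventually.of_forall fun N => ?_
    dsimp only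
    rw [gridPayoff, dif_neg h, truncPayoff_of_forall_notMem _ _ (not_exists.1 h)]

theorem norm_gridPayoff_le (hγ : ‖γ‖ ≤ 1) {C : ℝ} (hC : ∀ e, ‖φ e‖ ≤ C) (e : S × S × S)
    (ξ : ℕ → S) : ‖gridPayoff D φ γ e ξ‖ ≤ C :=
  le_of_tendsto (tendsto_truncPayoff e ξ).norm
    (Eventually.of_forall fun N => norm_truncPayoff_le hγ hC N e ξ)

theorem measurable_truncPayoff {Ω : Type*} [MeasurableSpace Ω] (N : ℕ) (e : S × S × S)
    (ξ : ℕ → Ω → S) (hξ : ∀ k, Measurable (ξ k)) :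
    Measurable fun ω => truncPayoff D φ γ N e fun k => ξ k ω := by
  induction N generalizing e ξ with
  | zero => simp only [truncPayoff]; exact measurable_const
  | succ N ih =>
    by_cases he : e ∈ D
    · simp only [truncPayoff, if_pos he]; exact measurable_const
    · simp only [truncPayoff, if_neg he]
      refine Measurable.const_mul ?_ _
      have : Measurable (Function.uncurry fun (z : S) (ω : Ω) =>
          truncPayoff D φ γ N (moveTo e z) fun k => ξ (k + 1) ω) :=
        measurable_from_prod_countable_right fun z =>
          ih (moveTo e z) (fun k => ξ (k + 1)) fun k => hξ (k + 1)
      exact this.comp ((hξ 0).prodMk measurable_id)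

end discrete

section chain

variable {Ω : Type*} [MeasurableSpace Ω] {G : Matrix S S ℝ} {μ : S → Measure Ω}
  {Y : ℝ≥0 → Ω → S}

theorem IsCTMC.cylinder_prob (hG : IsRateMatrix G) (hY : IsCTMC G μ Y) (h : ℝ≥0) (k : ℕ)
    (z : ℕ → S) :
    (μ (z 0)).real {ω | ∀ i ≤ k, Y (i * h) ω = z i} =
      ∏ i ∈ Finset.range k, NormedSpace.exp ((h : ℝ) • G) (z i) (z (i + 1)) := by
  have hm : Monotone fun i : ℕ => (i : ℝ≥0) * h := fun i j hij =>
    mul_le_mul_of_nonneg_right (Nat.cast_le.2 hij) zero_le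
  have hstep : ∀ i : ℕ, ((((i + 1 : ℕ) : ℝ≥0) * h : ℝ≥0) : ℝ) - (((i : ℝ≥0) * h : ℝ≥0) : ℝ) = h :=
    fun i => by push_cast; ring
  rw [measureReal_def, hY.fdd (z 0) k (fun i => i * h) z hm (by simp) rfl, ENNReal.toReal_ofReal]
  · simp only [hstep]
  · simp only [hstep]
    refine Finset.prod_nonneg fun i _ => exp_apply_nonneg_of_offDiag (fun a b hab => ?_) _ _
    exact mul_nonneg h.2 (hG.offDiag_nonneg a b hab)

theorem IsCTMC.ae_zero_eq (hY : IsCTMC G μ Y) (x : S) : ∀ᵐ ω ∂(μ x), Y 0 ω = x := by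
  have := hY.prob x
  have := hY.fdd x 0 (fun _ => 0) (fun _ => x) monotone_const rfl rfl
  simp only [Finset.range_zero, Finset.prod_empty, ENNReal.ofReal_one, nonpos_iff_eq_zero,
    forall_eq] at this
  exact (prob_compl_eq_zero_iff ((hY.measurable 0) (measurableSet_singleton x))).2 this

variable {D : Set (S × S × S)} {φ : S × S × S → ℂ} {γ : ℂ}

theorem integrable_truncPayoff (hY : IsCTMC G μ Y) (hγ : ‖γ‖ ≤ 1) (x : S) (N : ℕ)
    (e : S × S × S) (ξ : ℕ → Ω → S) (hξ : ∀ k, Measurable (ξ k)) :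
    Integrable (fun ω => truncPayoff D φ γ N e fun k => ξ k ω) (μ x) := by
  have := hY.prob x
  refine Integrable.of_bound (measurable_truncPayoff N e ξ hξ).aestronglyMeasurable
    (∑ e, ‖φ e‖) (Eventually.of_forall fun ω => norm_truncPayoff_le hγ (fun e => ?_) _ _ _)
  exact Finset.single_le_sum (f := fun e => ‖φ e‖) (fun _ _ => norm_nonneg _) (Finset.mem_univ e)

theorem setIntegral_truncPayoff (hG : IsRateMatrix G) (hY : IsCTMC G μ Y) (hγ : ‖γ‖ ≤ 1)
    (h : ℝ≥0) (N k : ℕ) (z : ℕ → S) (e : S × S × S) (he : e.1 = z k) :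
    ∫ ω in {ω | ∀ i ≤ k, Y (i * h) ω = z i},
        truncPayoff D φ γ N e (fun j => Y ((k + j + 1 : ℕ) * h) ω) ∂(μ (z 0)) =
      ((∏ i ∈ Finset.range k, NormedSpace.exp ((h : ℝ) • G) (z i) (z (i + 1)) : ℝ) : ℂ) *
        truncValue D φ γ (NormedSpace.exp ((h : ℝ) • G)) N e := by
  have hconst : ∀ c : ℂ, ∫ ω in {ω | ∀ i ≤ k, Y (i * h) ω = z i}, c ∂(μ (z 0)) =
      ((∏ i ∈ Finset.range k, NormedSpace.exp ((h : ℝ) • G) (z i) (z (i + 1)) : ℝ) : ℂ) * c :=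
    fun c => by
      rw [setIntegral_const, hY.cylinder_prob hG, Complex.real_smul]
  induction N generalizing k z e with
  | zero => simp only [truncPayoff, truncValue]; exact hconst _
  | succ N ih =>
    by_cases hD : e ∈ D
    · simp only [truncPayoff, truncValue, if_pos hD]; exact hconst _
    · simp only [truncPayoff, truncValue, if_neg hD]
      set z' : S → ℕ → S := fun c => Function.update z (k + 1) c with hz'
      have hlow : ∀ c, ∀ i ≤ k, z' c i = z i := fun c i hi =>
        Function.update_of_ne (by omega) _ _
      have htop : ∀ c, z' c (k + 1) = c := fun c => Function.update_self _ _ _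
      have hcyl : ∀ (c : S) (ω : Ω), (∀ i ≤ k + 1, Y (i * h) ω = z' c i) ↔
          (∀ i ≤ k, Y (i * h) ω = z i) ∧ Y ((k + 1 : ℕ) * h) ω = c := fun c ω => by
        constructor
        · intro H
          exact ⟨fun i hi => (H i (by omega)).trans (hlow c i hi),
            (H (k + 1) le_rfl).trans (htop c)⟩
        · rintro ⟨H, H'⟩ i hi
          rcases Nat.lt_or_ge k i with hki | hki
          · obtain rfl : i = k + 1 := by omega
            rw [H', htop]
          · rw [H i hki, hlow c i hki]
      have hmeas : ∀ c, MeasurableSet {ω | ∀ i ≤ k + 1, Y (i * h) ω = z' c i} := fun c => by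
        have : {ω | ∀ i ≤ k + 1, Y (i * h) ω = z' c i} =
            ⋂ i, ⋂ (_ : i ≤ k + 1), Y (i * h) ⁻¹' {z' c i} := by ext; simp
        rw [this]
        exact MeasurableSet.iInter fun i => MeasurableSet.iInter fun _ =>
          hY.measurable _ (measurableSet_singleton _)
      have hunion : {ω | ∀ i ≤ k, Y (i * h) ω = z i} =
          ⋃ c, {ω | ∀ i ≤ k + 1, Y (i * h) ω = z' c i} := by
        ext ω
        simp only [Set.mem_ofPred_eq, Set.mem_iUnion, hcyl]
        simp
      have hdisj : Pairwise (Function.onFun Disjoint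
          fun c => {ω | ∀ i ≤ k + 1, Y (i * h) ω = z' c i}) := fun c c' hcc => by
        refine Set.disjoint_left.2 fun ω h1 h2 => hcc ?_
        exact ((hcyl c ω).1 h1).2.symm.trans ((hcyl c' ω).1 h2).2
      have hint : Integrable (fun ω => γ * truncPayoff D φ γ N (moveTo e (Y ((k + 0 + 1 : ℕ) * h) ω))
          fun j => Y ((k + (j + 1) + 1 : ℕ) * h) ω) (μ (z 0)) := by
        have := integrable_truncPayoff (D := D) (φ := φ) hY hγ (z 0) (N + 1) e
          (fun j => Y ((k + j + 1 : ℕ) * h)) fun j => hY.measurable _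
        simpa only [truncPayoff, if_neg hD] using this
      rw [hunion, integral_iUnion_fintype hmeas hdisj fun c => hint.integrableOn,
        Finset.mul_sum, Finset.mul_sum]
      refine Finset.sum_congr rfl fun c _ => ?_
      have hc := ih (k + 1) (z' c) (moveTo e c) (htop c).symm (fun a => by
        rw [setIntegral_const, hY.cylinder_prob hG, Complex.real_smul])
      rw [hlow c 0 (Nat.zero_le k), Finset.prod_range_succ, htop, hlow c k le_rfl, ← he] at hc
      have hprod : ∏ i ∈ Finset.range k, NormedSpace.exp ((h : ℝ) • G) (z' c i) (z' c (i + 1)) =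
          ∏ i ∈ Finset.range k, NormedSpace.exp ((h : ℝ) • G) (z i) (z (i + 1)) :=
        Finset.prod_congr rfl fun i hi => by
          have := Finset.mem_range.1 hi
          rw [hlow c i (by omega), hlow c (i + 1) (by omega)]
      rw [hprod] at hc
      have hcongr : ∫ ω in {ω | ∀ i ≤ k + 1, Y (i * h) ω = z' c i},
          γ * truncPayoff D φ γ N (moveTo e (Y ((k + 0 + 1 : ℕ) * h) ω))
            (fun j => Y ((k + (j + 1) + 1 : ℕ) * h) ω) ∂(μ (z 0)) =
          γ * ∫ ω in {ω | ∀ i ≤ k + 1, Y (i * h) ω = z' c i},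
            truncPayoff D φ γ N (moveTo e c)
              (fun j => Y ((k + 1 + j + 1 : ℕ) * h) ω) ∂(μ (z 0)) := by
        rw [← integral_const_mul]
        refine setIntegral_congr_fun (hmeas c) fun ω hω => ?_
        have h1 : Y ((k + 0 + 1 : ℕ) * h) ω = c := ((hcyl c ω).1 hω).2
        have h2 : ∀ j, k + (j + 1) + 1 = k + 1 + j + 1 := fun j => by omega
        simp only [h1, h2]
      rw [hcongr, hc]
      push_cast
      ring

/-- Expected payoff of the chain observed along the grid of mesh `h`. -/
noncomputable def gridValue (μ : S → Measure Ω) (Y : ℝ≥0 → Ω → S) (D : Set (S × S × S))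
    (φ : S × S × S → ℂ) (γ : ℂ) (h : ℝ≥0) (e : S × S × S) : ℂ :=
  ∫ ω, gridPayoff D φ γ e (fun j => Y ((j + 1 : ℕ) * h) ω) ∂(μ e.1)

theorem tendsto_truncValue (hG : IsRateMatrix G) (hY : IsCTMC G μ Y) (hγ : ‖γ‖ ≤ 1) (h : ℝ≥0)
    (e : S × S × S) :
    Tendsto (fun N => truncValue D φ γ (NormedSpace.exp ((h : ℝ) • G)) N e) atTop
      (𝓝 (gridValue μ Y D φ γ h e)) := by
  have := hY.prob e.1
  have key : ∀ N, truncValue D φ γ (NormedSpace.exp ((h : ℝ) • G)) N e =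
      ∫ ω, truncPayoff D φ γ N e (fun j => Y ((j + 1 : ℕ) * h) ω) ∂(μ e.1) := fun N => by
    have := setIntegral_truncPayoff (D := D) (φ := φ) hG hY hγ h N 0 (fun _ => e.1) e rfl
    simp only [nonpos_iff_eq_zero, forall_eq, Nat.cast_zero, zero_mul, zero_add,
      Finset.range_zero, Finset.prod_empty, Complex.ofReal_one, one_mul] at this
    rw [← this]
    refine setIntegral_eq_integral_of_ae_compl_eq_zero ?_
    filter_upwards [hY.ae_zero_eq e.1] with ω hω hω'
    exact absurd hω hω'
  simp only [key]
  refine tendsto_integral_of_dominated_convergence (fun _ => ∑ e, ‖φ e‖)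
    (fun N => (measurable_truncPayoff N e _ fun j => hY.measurable _).aestronglyMeasurable)
    (integrable_const _) (fun N => Eventually.of_forall fun ω =>
      norm_truncPayoff_le hγ (fun e => ?_) _ _ _)
    (Eventually.of_forall fun ω => tendsto_truncPayoff e _)
  exact Finset.single_le_sum (f := fun e => ‖φ e‖) (fun _ _ => norm_nonneg _) (Finset.mem_univ e)

theorem gridValue_eq (hG : IsRateMatrix G) (hY : IsCTMC G μ Y) (hγ : ‖γ‖ ≤ 1) (h : ℝ≥0)
    {e : S × S × S} (he : e ∉ D) :
    gridValue μ Y D φ γ h e =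
      γ * ∑ z, NormedSpace.exp ((h : ℝ) • G) e.1 z * gridValue μ Y D φ γ h (moveTo e z) := by
  have h1 := (tendsto_add_atTop_iff_nat 1).2
    (tendsto_truncValue (D := D) (φ := φ) hG hY hγ h e)
  simp only [truncValue, if_neg he] at h1
  exact tendsto_nhds_unique h1 ((tendsto_finsetSum _ fun z _ =>
    (tendsto_truncValue hG hY hγ h (moveTo e z)).const_mul _).const_mul _)

/-! ### The generator equation -/

/-- Expected discounted payoff `φ` at the first entrance of the chain, its running maximum and its
running minimum in `D`, starting from `e`. -/
noncomputable def stoppedValue (μ : S → Measure Ω) (Y : ℝ≥0 → Ω → S) (D : Set (S × S × S))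
    (φ : S × S × S → ℂ) (q : ℂ) (e : S × S × S) : ℂ :=
  ∫ ω, stoppedPayoff D φ q e.2.1 e.2.2 (fun t => Y t ω) ∂(μ e.1)

theorem stoppedValue_of_mem (hY : IsCTMC G μ Y) (q : ℂ) {s M m : S} (hM : s ≤ M) (hm : m ≤ s)
    (he : (s, M, m) ∈ D) : stoppedValue μ Y D φ q (s, M, m) = φ (s, M, m) := by
  have := hY.prob s
  have : ∀ᵐ ω ∂(μ s), stoppedPayoff D φ q M m (fun t => Y t ω) = φ (s, M, m) := by
    filter_upwards [hY.ae_zero_eq s] with ω hω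
    have h0 : stateAt M m (fun t => Y t ω) 0 = (s, M, m) := by
      rw [stateAt_zero] <;> simp [hω, hM, hm]
    rw [stoppedPayoff_of_first (T := 0) (by rwa [h0]) (fun t ht => absurd ht (not_lt_zero)), h0]
    simp
  rw [stoppedValue, integral_congr_ae this]
  simp

theorem norm_exp_neg_mul_le {q : ℂ} (hq : 0 < q.re) (h : ℝ≥0) :
    ‖Complex.exp (-q * (h : ℂ))‖ ≤ 1 := by
  rw [Complex.norm_exp, Real.exp_le_one_iff]
  have : (-q * (h : ℂ)).re = -(q.re * h) := by simp
  rw [this]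
  exact neg_nonpos.2 (mul_nonneg hq.le h.2)

theorem tendsto_gridValue (hY : IsCTMC G μ Y) {q : ℂ} (hq : 0 < q.re) {e : S × S × S}
    (hM : e.1 ≤ e.2.1) (hm : e.2.2 ≤ e.1) :
    Tendsto (fun h : ℝ≥0 => gridValue μ Y D φ (Complex.exp (-q * (h : ℂ))) h e) (𝓝[>] 0)
      (𝓝 (stoppedValue μ Y D φ q e)) := by
  have := hY.prob e.1
  have hC : ∀ e, ‖φ e‖ ≤ ∑ e, ‖φ e‖ := fun e =>
    Finset.single_le_sum (f := fun e => ‖φ e‖) (fun _ _ => norm_nonneg _) (Finset.mem_univ e)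
  refine tendsto_integral_filter_of_dominated_convergence (fun _ => ∑ e, ‖φ e‖)
    (Eventually.of_forall fun h => ?_) (Eventually.of_forall fun h => Eventually.of_forall fun ω =>
      norm_gridPayoff_le (norm_exp_neg_mul_le hq h) hC _ _) (integrable_const _) ?_
  · exact aestronglyMeasurable_of_tendsto_ae atTop
      (fun N => (measurable_truncPayoff N e _ fun j => hY.measurable _).aestronglyMeasurable)
      (Eventually.of_forall fun ω => tendsto_truncPayoff e _)
  · filter_upwards [hY.ae_zero_eq e.1] with ω hω
    have := tendsto_gridPayoff (p := fun t => Y t ω) (hY.rightCont ω) (M := e.2.1) (m := e.2.2)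
      (by simpa [hω] using hM) (by simpa [hω] using hm) D φ q
    simpa only [hω] using this

theorem tendsto_cexp_slope (q : ℂ) :
    Tendsto (fun h : ℝ≥0 => (Complex.exp (q * (h : ℂ)) - 1) / (h : ℂ)) (𝓝[>] 0) (𝓝 q) := by
  have hd : HasDerivAt (fun u : ℂ => Complex.exp (q * u)) q 0 := by
    simpa using ((hasDerivAt_id (0 : ℂ)).const_mul q).cexp
  have hcoe : Tendsto (fun h : ℝ≥0 => (h : ℂ)) (𝓝[>] 0) (𝓝[≠] 0) := by
    refine tendsto_nhdsWithin_iff.2 ⟨?_, ?_⟩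
    · have hc : Continuous fun h : ℝ≥0 => (h : ℂ) := by fun_prop
      simpa using (hc.tendsto 0).mono_left nhdsWithin_le_nhds
    · filter_upwards [self_mem_nhdsWithin] with h h0
      simpa using ne_of_gt (Set.mem_Ioi.1 h0)
  refine ((hasDerivAt_iff_tendsto_slope.1 hd).comp hcoe).congr fun h => ?_
  simp [slope, div_eq_inv_mul]

theorem stoppedValue_generator (hG : IsRateMatrix G) (hY : IsCTMC G μ Y) {q : ℂ} (hq : 0 < q.re)
    {e : S × S × S} (hM : e.1 ≤ e.2.1) (hm : e.2.2 ≤ e.1) (he : e ∉ D) :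
    q * stoppedValue μ Y D φ q e = ∑ z, (G e.1 z : ℂ) * stoppedValue μ Y D φ q (moveTo e z) := by
  have hself : moveTo e e.1 = e := by
    unfold moveTo
    rw [sup_eq_left.2 hM, inf_eq_left.2 hm]
  have hl := (tendsto_cexp_slope q).mul (tendsto_gridValue (D := D) (φ := φ) hY hq hM hm)
  have hr : Tendsto (fun h : ℝ≥0 => ∑ z, (((NormedSpace.exp ((h : ℝ) • G) e.1 z -
      (1 : Matrix S S ℝ) e.1 z) / h : ℝ) : ℂ) *
        gridValue μ Y D φ (Complex.exp (-q * (h : ℂ))) h (moveTo e z)) (𝓝[>] 0)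
      (𝓝 (∑ z, (G e.1 z : ℂ) * stoppedValue μ Y D φ q (moveTo e z))) :=
    tendsto_finsetSum _ fun z _ =>
      ((Complex.continuous_ofReal.tendsto _).comp (tendsto_exp_smul_slope G e.1 z)).mul
        (tendsto_gridValue hY hq le_sup_right inf_le_right)
  refine tendsto_nhds_unique hl (hr.congr' ?_)
  filter_upwards [self_mem_nhdsWithin] with h h0
  have hh : (h : ℂ) ≠ 0 := by simpa using ne_of_gt (Set.mem_Ioi.1 h0)
  have heq := gridValue_eq (D := D) (φ := φ) hG hY (norm_exp_neg_mul_le hq h) h he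
  set V := gridValue μ Y D φ (Complex.exp (-q * (h : ℂ))) h with hV
  have hinv : Complex.exp (q * (h : ℂ)) * V e =
      ∑ z, (NormedSpace.exp ((h : ℝ) • G) e.1 z : ℂ) * V (moveTo e z) := by
    conv_lhs => rw [heq]
    rw [← mul_assoc, ← Complex.exp_add]
    simp
  have hone : ∑ z, ((1 : Matrix S S ℝ) e.1 z : ℂ) * V (moveTo e z) = V e := by
    rw [Finset.sum_eq_single e.1]
    · simp [hself]
    · intro z _ hz
      simp [Matrix.one_apply_ne' hz]
    · simp
  rw [div_mul_eq_mul_div, sub_mul, one_mul, hinv]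
  conv_rhs => rw [← hone]
  rw [← Finset.sum_sub_distrib, Finset.sum_div]
  refine Finset.sum_congr rfl fun z _ => ?_
  push_cast
  ring

end chain

/-! ### First passage, drawdown and drawup as stopped values -/

section identification

variable {Ω : Type*} [MeasurableSpace Ω] {G : Matrix S S ℝ} {μ : S → Measure Ω}
  {Y : ℝ≥0 → Ω → S}

theorem exitP_eq_stoppedValue (hY : IsCTMC G μ Y) (U : Set ℝ) (q : ℂ) (x M m : S) (f : S → ℂ) :
    exitP μ Y U q x f = stoppedValue μ Y {e | (e.1 : ℝ) ∉ U} (fun e => f e.1) q (x, M, m) := by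
  unfold exitP stoppedValue
  congr 1
  funext ω
  rw [exitTime_eq_hitTime (hY.rightCont ω)]
  rfl

open Classical in
theorem upExitR_eq_stoppedValue (hY : IsCTMC G μ Y) {ℓ r : ℝ} (hlr : ℓ < r) (q : ℂ) (x M y : S)
    (g : S → S → ℂ) :
    upExitR μ Y ℓ r q x y g = stoppedValue μ Y {e | (e.1 : ℝ) ∉ Set.Ioc ℓ r}
      (fun e => if r < (e.1 : ℝ) then g e.1 e.2.2 else 0) q (x, M, y) := by
  unfold upExitR stoppedValue
  congr 1
  funext ω
  have hp := hY.rightCont ω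
  dsimp only
  rw [exitTime_eq_hitTime hp, exitTime_eq_hitTime hp]
  set p : ℝ≥0 → S := fun t => Y t ω with hpdef
  have hD : ∀ t, stateAt M y p t ∈ {e : S × S × S | (e.1 : ℝ) ∉ Set.Ioc ℓ r} ↔
      (p t : ℝ) ∉ Set.Iic r ∨ (p t : ℝ) ∉ Set.Ioi ℓ := fun t => by
    simp only [stateAt, Set.mem_ofPred_eq, Set.mem_Ioc, Set.mem_Iic, Set.mem_Ioi]
    tauto
  have hsr : RightStable fun t => (p t : ℝ) ∉ Set.Iic r :=
    rightStable_stateAt hp M y fun e => (e.1 : ℝ) ∉ Set.Iic r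
  have hsl : RightStable fun t => (p t : ℝ) ∉ Set.Ioi ℓ :=
    rightStable_stateAt hp M y fun e => (e.1 : ℝ) ∉ Set.Ioi ℓ
  by_cases hlt : hitTime (fun t => (p t : ℝ) ∉ Set.Iic r) < hitTime fun t => (p t : ℝ) ∉ Set.Ioi ℓ
  · rw [if_pos hlt]
    rcases hsr.hitTime_spec with ⟨h, -⟩ | ⟨T, h, hT, hT'⟩
    · exact absurd (h ▸ hlt) not_top_lt
    · rw [h] at hlt ⊢
      rw [stoppedPayoff_of_first ((hD T).2 (Or.inl hT))]
      · rw [if_pos (show r < ((stateAt M y p T).1 : ℝ) from not_le.1 hT)]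
        rfl
      · intro t ht htD
        rcases (hD t).1 htD with h1 | h1
        · exact hT' t ht h1
        · exact absurd (hitTime_le h1) (not_le.2 ((ENNReal.coe_lt_coe.2 ht).trans hlt))
  · rw [if_neg hlt]
    rw [not_lt] at hlt
    rcases hsl.hitTime_spec with ⟨h, hl⟩ | ⟨T, h, hT, hT'⟩
    · rw [h, top_le_iff] at hlt
      rw [stoppedPayoff_of_forall_notMem]
      intro t ht
      rcases (hD t).1 ht with h1 | h1
      · exact absurd (hitTime_le h1) (by rw [hlt]; simp)
      · exact hl t h1
    · rw [h] at hlt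
      rw [stoppedPayoff_of_first ((hD T).2 (Or.inr hT))]
      · have : ¬ r < (p T : ℝ) := not_lt.2 ((not_lt.1 hT).trans hlr.le)
        simp [stateAt, this]
      · intro t ht htD
        rcases (hD t).1 htD with h1 | h1
        · exact absurd (hlt.trans (hitTime_le h1)) (not_le.2 (ENNReal.coe_lt_coe.2 ht))
        · exact hT' t ht h1

/-- States at which the drawdown has reached `a` or the drawup has reached `b`. -/
def drawSet (S : Finset ℝ) (a b : ℝ) : Set (S × S × S) :=
  {e | a ≤ (e.2.1 : ℝ) - e.1 ∨ b ≤ (e.1 : ℝ) - e.2.2}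

open Classical in
/-- The payoff `f`, received if it is the drawdown that has reached its level. -/
noncomputable def drawPayoff (b : ℝ) (f : S → ℂ) (e : S × S × S) : ℂ :=
  if b ≤ (e.1 : ℝ) - e.2.2 then 0 else f e.1

theorem drawdownA_eq_stoppedValue (hY : IsCTMC G μ Y) (a b : ℝ) (f : S → ℂ) (q : ℂ) (x y : S) :
    drawdownA μ Y a b f q x y =
      stoppedValue μ Y (drawSet S a b) (drawPayoff b f) q (x, x, y) := by
  classical
  unfold drawdownA stoppedValue
  congr 1
  funext ω
  have hp := hY.rightCont ω
  dsimp only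
  set p : ℝ≥0 → S := fun t => Y t ω with hpdef
  have hdd : drawdownTime a x p = hitTime fun t => a ≤ (runMax x p t : ℝ) - (p t : ℝ) := rfl
  have hdu : drawupTime b y p = hitTime fun t => b ≤ (p t : ℝ) - (runMin y p t : ℝ) := rfl
  rw [hdd, hdu]
  have hD : ∀ t, stateAt x y p t ∈ drawSet S a b ↔
      a ≤ (runMax x p t : ℝ) - (p t : ℝ) ∨ b ≤ (p t : ℝ) - (runMin y p t : ℝ) := fun t => Iff.rfl
  have hsd : RightStable fun t => a ≤ (runMax x p t : ℝ) - (p t : ℝ) :=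
    rightStable_stateAt hp x y fun e => a ≤ (e.2.1 : ℝ) - e.1
  have hsu : RightStable fun t => b ≤ (p t : ℝ) - (runMin y p t : ℝ) :=
    rightStable_stateAt hp x y fun e => b ≤ (e.1 : ℝ) - e.2.2
  by_cases hlt : hitTime (fun t => a ≤ (runMax x p t : ℝ) - (p t : ℝ)) <
      hitTime fun t => b ≤ (p t : ℝ) - (runMin y p t : ℝ)
  · rw [if_pos hlt]
    rcases hsd.hitTime_spec with ⟨h, -⟩ | ⟨T, h, hT, hT'⟩
    · exact absurd (h ▸ hlt) not_top_lt
    · rw [h] at hlt ⊢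
      rw [stoppedPayoff_of_first ((hD T).2 (Or.inl hT))]
      · have : ¬ b ≤ (p T : ℝ) - (runMin y p T : ℝ) := fun h1 =>
          absurd (hitTime_le h1) (not_le.2 hlt)
        rw [show drawPayoff b f (stateAt x y p T) = f (p T) from if_neg this]
        rfl
      · intro t ht htD
        rcases (hD t).1 htD with h1 | h1
        · exact hT' t ht h1
        · exact absurd (hitTime_le h1) (not_le.2 ((ENNReal.coe_lt_coe.2 ht).trans hlt))
  · rw [if_neg hlt]
    rw [not_lt] at hlt
    rcases hsu.hitTime_spec with ⟨h, hl⟩ | ⟨T, h, hT, hT'⟩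
    · rw [h, top_le_iff] at hlt
      rw [stoppedPayoff_of_forall_notMem]
      intro t ht
      rcases (hD t).1 ht with h1 | h1
      · exact absurd (hitTime_le h1) (by rw [hlt]; simp)
      · exact hl t h1
    · rw [h] at hlt
      rw [stoppedPayoff_of_first ((hD T).2 (Or.inr hT))]
      · rw [show drawPayoff b f (stateAt x y p T) = 0 from if_pos hT, mul_zero]
      · intro t ht htD
        rcases (hD t).1 htD with h1 | h1
        · exact absurd (hlt.trans (hitTime_le h1)) (not_le.2 (ENNReal.coe_lt_coe.2 ht))
        · exact hT' t ht h1

variable {q : ℂ}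

theorem exitP_generator (hG : IsRateMatrix G) (hY : IsCTMC G μ Y) (hq : 0 < q.re) (f : S → ℂ)
    {U : Set ℝ} {x : S} (hx : (x : ℝ) ∈ U) :
    q * exitP μ Y U q x f = ∑ z, (G x z : ℂ) * exitP μ Y U q z f := by
  rw [exitP_eq_stoppedValue hY U q x x x f,
    stoppedValue_generator hG hY hq le_rfl le_rfl (by simpa using hx)]
  exact Finset.sum_congr rfl fun z _ => by
    rw [exitP_eq_stoppedValue hY U q z (x ⊔ z) (x ⊓ z) f]; rfl

theorem exitP_of_notMem (hY : IsCTMC G μ Y) (f : S → ℂ) {U : Set ℝ} {x : S} (hx : (x : ℝ) ∉ U) :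
    exitP μ Y U q x f = f x := by
  rw [exitP_eq_stoppedValue hY U q x x x f,
    stoppedValue_of_mem hY q le_rfl le_rfl (by simpa using hx)]

theorem upExitR_generator (hG : IsRateMatrix G) (hY : IsCTMC G μ Y) (hq : 0 < q.re) {ℓ r : ℝ}
    (hlr : ℓ < r) (g : S → S → ℂ) {x y : S} (hyx : y ≤ x) (hx : (x : ℝ) ∈ Set.Ioc ℓ r) :
    q * upExitR μ Y ℓ r q x y g = ∑ z, (G x z : ℂ) * upExitR μ Y ℓ r q z (min y z) g := by
  rw [upExitR_eq_stoppedValue hY hlr q x x y g,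
    stoppedValue_generator hG hY hq le_rfl hyx (by simpa using hx)]
  exact Finset.sum_congr rfl fun z _ => by
    rw [upExitR_eq_stoppedValue hY hlr q z (x ⊔ z) (min y z) g]; rfl

theorem upExitR_of_notMem (hY : IsCTMC G μ Y) {ℓ r : ℝ} (hlr : ℓ < r) (g : S → S → ℂ) {x y : S}
    (hyx : y ≤ x) (hx : (x : ℝ) ∉ Set.Ioc ℓ r) :
    upExitR μ Y ℓ r q x y g = g x y * (if r < (x : ℝ) then 1 else 0) := by
  rw [upExitR_eq_stoppedValue hY hlr q x x y g,
    stoppedValue_of_mem hY q le_rfl hyx (by simpa only [Set.mem_ofPred_eq] using hx)]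
  simp

end identification

/-! ### Uniqueness for the generator equation -/

theorem IsRateMatrix.eq_zero_of_generator {G : Matrix S S ℝ} (hG : IsRateMatrix G) {q : ℂ}
    (hq : 0 < q.re) (I : Finset (S × S)) (u : S × S → ℂ)
    (hu : ∀ e ∈ I, q * u e = ∑ z, (G e.1 z : ℂ) * u (z, min e.2 z))
    (hle : ∀ e ∈ I, e.2 ≤ e.1)
    (hbd : ∀ e ∈ I, ∀ z, (z, min e.2 z) ∉ I → u (z, min e.2 z) = 0) :
    ∀ e ∈ I, u e = 0 := by
  intro e₀ he₀
  obtain ⟨e, he, hmax⟩ := I.exists_max_image (fun e => ‖u e‖) ⟨e₀, he₀⟩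
  suffices h : ‖u e‖ ≤ 0 from norm_le_zero_iff.1 ((hmax e₀ he₀).trans h)
  have hself : (e.1, min e.2 e.1) = e := by rw [min_eq_left (hle e he)]
  have hb : ∀ z, ‖u (z, min e.2 z)‖ ≤ ‖u e‖ := fun z => by
    by_cases hz : (z, min e.2 z) ∈ I
    · exact hmax _ hz
    · rw [hbd e he z hz, norm_zero]; exact norm_nonneg _
  set c : ℝ := ∑ z ∈ Finset.univ.erase e.1, G e.1 z with hc
  have h1 : (q + c) * u e = ∑ z ∈ Finset.univ.erase e.1, (G e.1 z : ℂ) * u (z, min e.2 z) := by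
    rw [add_mul, hu e he, ← Finset.add_sum_erase _ _ (Finset.mem_univ e.1), hself, hG.diag_eq, ← hc]
    push_cast
    ring
  have h2 : ‖(q + c) * u e‖ ≤ c * ‖u e‖ := by
    rw [h1, hc, Finset.sum_mul]
    refine norm_sum_le_of_le _ fun z hz => ?_
    have hz0 := hG.offDiag_nonneg e.1 z (Finset.ne_of_mem_erase hz)
    rw [norm_mul, Complex.norm_real, Real.norm_of_nonneg hz0]
    exact mul_le_mul_of_nonneg_left (hb z) hz0
  have h3 : q.re + c ≤ ‖q + c‖ := by
    have := Complex.re_le_norm (q + c)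
    simpa using this
  rw [norm_mul] at h2
  have h4 := mul_le_mul_of_nonneg_right h3 (norm_nonneg (u e))
  have h5 : q.re * ‖u e‖ ≤ 0 := by linarith
  exact nonpos_of_mul_nonpos_right h5 hq

/-! ### The drawdown-before-drawup recursion -/

section recursion

variable {Ω : Type*} [MeasurableSpace Ω] {G : Matrix S S ℝ} {μ : S → Measure Ω}
  {Y : ℝ≥0 → Ω → S} {q : ℂ}

theorem drawdownA_eq_exitP_add_sum (hG : IsRateMatrix G) (hY : IsCTMC G μ Y) (hq : 0 < q.re)
    {a b : ℝ} (hab : a ≤ b) (f : S → ℂ) {x y : S}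
    (hy : (y : ℝ) ∈ Set.Ioc ((x : ℝ) - a) (x : ℝ)) :
    drawdownA μ Y a b f q x y =
      exitP μ Y (Set.Ioc ((x : ℝ) - a) (x : ℝ)) q x
        (fun s => if (s : ℝ) ≤ (x : ℝ) - a then f s else 0) +
      ∑ z ∈ Finset.univ.filter (fun z : S => (z : ℝ) ∈ Set.Ioo (x : ℝ) ((y : ℝ) + b)),
        ∑ w ∈ Finset.univ.filter
            (fun w : S => (w : ℝ) ∈ Set.Ioc (max ((x : ℝ) - a) ((z : ℝ) - b)) (y : ℝ)),
          upExitR μ Y ((x : ℝ) - a) (x : ℝ) q x y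
            (fun s m => if s = z ∧ m = w then 1 else 0) *
          drawdownA μ Y a b f q z w := by
  classical
  have ha : 0 < a := by linarith [hy.1, hy.2]
  have hlr : (x : ℝ) - a < x := by linarith
  set U := Set.Ioc ((x : ℝ) - a) (x : ℝ) with hU
  set Z := Finset.univ.filter (fun z : S => (z : ℝ) ∈ Set.Ioo (x : ℝ) ((y : ℝ) + b)) with hZ
  set W : S → Finset S := fun z => Finset.univ.filter
    (fun w : S => (w : ℝ) ∈ Set.Ioc (max ((x : ℝ) - a) ((z : ℝ) - b)) (y : ℝ)) with hW
  set F : S × S × S → ℂ := stoppedValue μ Y (drawSet S a b) (drawPayoff b f) q with hF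
  set f' : S → ℂ := fun s => if (s : ℝ) ≤ (x : ℝ) - a then f s else 0 with hf'
  set R : S → S → S × S → ℂ := fun z w e => upExitR μ Y ((x : ℝ) - a) (x : ℝ) q e.1 e.2
    (fun s m => if s = z ∧ m = w then 1 else 0) with hR
  set u : S × S → ℂ := fun e => F (e.1, x ⊔ e.1, e.2) -
    (exitP μ Y U q e.1 f' + ∑ z ∈ Z, ∑ w ∈ W z, R z w e * drawdownA μ Y a b f q z w) with hu
  set I : Finset (S × S) := Finset.univ.filter
    (fun e => (e.1 : ℝ) ∈ U ∧ (x : ℝ) - a < e.2 ∧ e.2 ≤ e.1 ∧ e.2 ≤ y) with hI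
  have hyx : y ≤ x := hy.2
  have hxU : (x : ℝ) ∈ U := ⟨hlr, le_rfl⟩
  have key := hG.eq_zero_of_generator hq I u ?_ ?_ ?_ (x, y)
    (by simp [hI, hxU, hy.1, hyx])
  · have hA := drawdownA_eq_stoppedValue hY a b f q x y
    simp only [hu, sup_idem] at key
    exact hA.trans (sub_eq_zero.1 key)
  · intro e he
    obtain ⟨heU, hea, hle, hey⟩ := (Finset.mem_filter.1 he).2
    have hex : e.1 ≤ x := heU.2
    have h1 : q * F (e.1, x ⊔ e.1, e.2) = ∑ z, (G e.1 z : ℂ) * F (z, x ⊔ z, min e.2 z) := by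
      rw [hF, stoppedValue_generator hG hY hq le_sup_right hle]
      · refine Finset.sum_congr rfl fun z _ => ?_
        simp only [moveTo, sup_eq_left.2 hex]
      · simp only [drawSet, Set.mem_ofPred_eq, sup_eq_left.2 hex, not_or, not_le]
        exact ⟨by linarith [heU.1], by linarith [heU.2]⟩
    have h2 := exitP_generator hG hY hq f' heU
    have h3 : ∀ z w, q * R z w e = ∑ c, (G e.1 c : ℂ) * R z w (c, min e.2 c) := fun z w =>
      upExitR_generator hG hY hq hlr _ hle heU
    simp only [hu, mul_sub, mul_add, h1, h2, Finset.sum_sub_distrib, Finset.sum_add_distrib]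
    congr 2
    simp only [Finset.mul_sum, ← mul_assoc, h3]
    simp only [Finset.sum_mul]
    conv_rhs => rw [Finset.sum_comm]
    refine Finset.sum_congr rfl fun z _ => ?_
    rw [Finset.sum_comm]
  · intro e he
    exact (Finset.mem_filter.1 he).2.2.2.1
  · intro e he z hz
    obtain ⟨heU, hea, hle, hey⟩ := (Finset.mem_filter.1 he).2
    have hzU : (z : ℝ) ∉ U := fun hzU => hz <| by
      simp only [hI, Finset.mem_filter, Finset.mem_univ, true_and]
      refine ⟨hzU, ?_, min_le_right _ _, (min_le_left _ _).trans hey⟩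
      rcases min_choice e.2 z with h | h <;> rw [h]
      · exact hea
      · exact hzU.1
    have hRz : ∀ c w, R c w (z, min e.2 z) =
        (if z = c ∧ min e.2 z = w then 1 else 0) * (if (x : ℝ) < z then 1 else 0) := fun c w =>
      upExitR_of_notMem hY hlr _ (min_le_right _ _) hzU
    simp only [hu, hRz, exitP_of_notMem hY f' hzU]
    by_cases hzx : (x : ℝ) < z
    · have hxz : x < z := hzx
      have hmin : min e.2 z = e.2 := min_eq_left ((hle.trans heU.2).trans hxz.le)
      have hf0 : f' z = 0 := if_neg (by linarith)
      rw [hmin, hf0, sup_eq_right.2 hxz.le, zero_add, sub_eq_zero]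
      simp only [hzx, if_true, mul_one]
      by_cases hb : b ≤ (z : ℝ) - e.2
      · rw [hF, stoppedValue_of_mem hY q le_rfl ((hle.trans heU.2).trans hxz.le) (Or.inr hb),
          drawPayoff, if_pos hb]
        refine (Finset.sum_eq_zero fun c _ => Finset.sum_eq_zero fun w hw => ?_).symm
        rw [if_neg, zero_mul]
        rintro ⟨rfl, rfl⟩
        have := (Finset.mem_filter.1 hw).2.1
        rw [max_lt_iff] at this
        linarith [this.2]
      · rw [not_le] at hb
        have hey' : (e.2 : ℝ) ≤ y := hey
        rw [Finset.sum_eq_single z, Finset.sum_eq_single e.2]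
        · rw [if_pos ⟨rfl, rfl⟩, one_mul, drawdownA_eq_stoppedValue hY]
        · intro w _ hw
          rw [if_neg (fun h => hw h.2.symm), zero_mul]
        · intro h
          refine absurd (Finset.mem_filter.2 ⟨Finset.mem_univ _, ?_, hey⟩) h
          exact max_lt hea (by linarith)
        · intro c _ hc
          refine Finset.sum_eq_zero fun w _ => ?_
          rw [if_neg (fun h => hc h.1.symm), zero_mul]
        · intro h
          refine absurd (Finset.mem_filter.2 ⟨Finset.mem_univ _, hzx, ?_⟩) h
          linarith
    · have hza : (z : ℝ) ≤ (x : ℝ) - a := by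
        by_contra h
        exact hzU ⟨not_le.1 h, not_lt.1 hzx⟩
      have hze : z ≤ e.2 := Subtype.coe_le_coe.1 (hza.trans hea.le)
      have hzx' : z ≤ x := not_lt.1 hzx
      simp only [hzx, if_false, mul_zero, zero_mul, Finset.sum_const_zero, add_zero]
      rw [min_eq_right hze, sup_eq_left.2 hzx', hF,
        stoppedValue_of_mem hY q hzx' le_rfl (Or.inl (by simp only; linarith)), drawPayoff,
        if_neg (by simp only [sub_self, not_le]; linarith),
        show f' z = f z from if_pos hza, sub_self]

end recursion

end CTMC

theorem mainTheorem2 {Ω : Type*} [MeasurableSpace Ω] (S : Finset ℝ) (G : Matrix S S ℝ)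
    (hG : CTMC.IsRateMatrix G) (μ : S → MeasureTheory.Measure Ω) (Y : ℝ≥0 → Ω → S)
    (hY : CTMC.IsCTMC G μ Y) (q : ℂ) (hq : 0 < q.re) :
    (∀ (a b : ℝ), a ≤ b → ∀ (f : S → ℂ) (x y : S), (y : ℝ) ∈ Set.Ioc ((x : ℝ) - a) (x : ℝ) →
      CTMC.drawdownA μ Y a b f q x y =
        CTMC.exitP μ Y (Set.Ioc ((x : ℝ) - a) (x : ℝ)) q x
          (fun s => if (s : ℝ) ≤ (x : ℝ) - a then f s else 0) +
        ∑ z ∈ Finset.univ.filter (fun z : S => (z : ℝ) ∈ Set.Ioo (x : ℝ) ((y : ℝ) + b)),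
          ∑ w ∈ Finset.univ.filter
              (fun w : S => (w : ℝ) ∈ Set.Ioc (max ((x : ℝ) - a) ((z : ℝ) - b)) (y : ℝ)),
            CTMC.upExitR μ Y ((x : ℝ) - a) (x : ℝ) q x y
              (fun s m => if s = z ∧ m = w then 1 else 0) *
            CTMC.drawdownA μ Y a b f q z w) ∧
    (∀ (ℓ r : ℝ), ℓ < r → ∀ (g : S → S → ℂ) (x y : S), (y : ℝ) ≤ (x : ℝ) →
      ((x : ℝ) ∈ Set.Ioc ℓ r →
        q * CTMC.upExitR μ Y ℓ r q x y g -
          ∑ z : S, (G x z : ℂ) * CTMC.upExitR μ Y ℓ r q z (min y z) g = 0) ∧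
      ((x : ℝ) ∉ Set.Ioc ℓ r →
        CTMC.upExitR μ Y ℓ r q x y g = g x y * (if r < (x : ℝ) then 1 else 0))) :=
  ⟨fun _ _ hab f _ _ hy => CTMC.drawdownA_eq_exitP_add_sum hG hY hq hab f hy,
    fun _ _ hlr g _ _ hyx => ⟨fun hx =>
      sub_eq_zero.2 (CTMC.upExitR_generator hG hY hq hlr g hyx hx),
      fun hx => CTMC.upExitR_of_notMem hY hlr g hyx hx⟩⟩
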